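/- For $n\ge 1$ let $\mathcal M_n$ be the set of positive definite complex $n\times n$ matrices of trace $1$ (a smooth manifold, open in the affine space of self-adjoint matrices of trace $1$), whose tangent space at each point is identified with the real vector space $\mathcal T_n$ of traceless self-adjoint $n\times n$ matrices. A linear map $\mathbf T:M_n(\mathbb C)\to M_m(\mathbb C)$ is called stochastic if it is completely positive and trace preserving. A metric is a family $g=(g_D)$ which assigns to every $n$ and every $D\in\mathcal M_n$ a real inner product $g_D$ on $\mathcal T_n$; it is Riemannian if for every $n$ and all $A,B\in\mathcal T_n$ the function $D\mapsto g_D(A,B)$ is smooth on $\mathcal M_n$. It is called - monotone if $g_{\mathbf T(D)}(\mathbf T(A),\mathbf T(A))\le g_D(A,A)$ for all $n,m$, all stochastic $\mathbf T:M_n(\mathbb C)\to M_m(\mathbb C)$, all $D\in\mathcal M_n$ with $\mathbf T(D)\in\mathcal M_m$ and all $A\in\mathcal T_n$; - Fisher-adjusted if it restricts to the classical Fisher metric on diagonal matrices: $g_{\mathrm{Diag}(p)}(\mathrm{Diag}(a),\mathrm{Diag}(b))=\sum_i a_ib_i/p_i$ whenever $p_i>0$, $\sum_i p_i=1$, $a_i,b_i\in\mathbb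 R$ and $\sum_i a_i=\sum_i b_i=0$. **Theorem 3.2 (the largest Fisher-adjusted monotone metric).** Put $$g^{\rm RL}_D(A,B)=\tfrac12\,\mathrm{Tr}\,D^{-1}(AB+BA)\qquad(D\in\mathcal M_n,\ A,B\in\mathcal T_n).$$ 1. $g^{\rm RL}$ is real valued and is a monotone, Fisher-adjusted Riemannian metric. 2. It corresponds to $f(t)=\frac{2t}{1+t}$ (the harmonic mean): $f$ is operator monotone, that is, $0\le K\le H$ implies $0\le f(K)\le f(H)$ for matrices of every size; $f(t)>0$ and $f(t)=t\,f(t^{-1})$ for $t>0$; and for $D=\mathrm{Diag}(p_1,\dots,p_n)\in\mathcal M_n$ and $A=(A_{jk})\in\mathcal T_n$, $$g^{\rm RL}_D(A,A)=\sum_{j,k=1}^n c(p_j,p_k)\,|A_{jk}|^2,\qquad c(x,y)=\frac1{y\,f(x/y)}.$$ 3. It is the largest: every monotone Fisher-adjusted metric $g$ (no regularity of $D\mapsto g_D$ is needed) satisfies $g_D(A,A)\le g^{\rm RL}_D(A,A)$ for all $n$, all $D\in\mathcal M_n$ and all $A\in\mathcal T_n$. -/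

import Mathlib

open scoped Matrix ContDiff ComplexOrder

namespace DensityMetric

/-- The set of invertible (i.e. positive definite) `n × n` density matrices. -/
def states (n : ℕ) : Set (Matrix (Fin n) (Fin n) ℂ) :=
  {D | D.PosDef ∧ D.trace = 1}

/-- The tangent space (the same at every state): the traceless self-adjoint matrices. -/
def tangent (n : ℕ) : Set (Matrix (Fin n) (Fin n) ℂ) :=
  {A | A.IsHermitian ∧ A.trace = 0}

/-- A field of bilinear forms on the `n × n` states, written as a function of the base point and
two tangent vectors. Only its values at `D ∈ states n` and `A, B ∈ tangent n` are meaningful; every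
condition below looks at these values only. -/
abbrev FormField (n : ℕ) : Type :=
  Matrix (Fin n) (Fin n) ℂ → Matrix (Fin n) (Fin n) ℂ → Matrix (Fin n) (Fin n) ℂ → ℝ

/-- At every state, the field is a (real) inner product on the tangent space. -/
structure IsInnerProductField {n : ℕ} (g : FormField n) : Prop where
  add_left : ∀ D ∈ states n, ∀ A ∈ tangent n, ∀ B ∈ tangent n, ∀ C ∈ tangent n,
    g D (A + B) C = g D A C + g D B C
  smul_left : ∀ D ∈ states n, ∀ (c : ℝ), ∀ A ∈ tangent n, ∀ B ∈ tangent n,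
    g D (c • A) B = c * g D A B
  symm : ∀ D ∈ states n, ∀ A ∈ tangent n, ∀ B ∈ tangent n, g D A B = g D B A
  pos : ∀ D ∈ states n, ∀ A ∈ tangent n, A ≠ 0 → 0 < g D A A

section Smooth

-- Smoothness on a finite-dimensional space does not depend on the choice of this norm.
attribute [local instance] Matrix.frobeniusNormedAddCommGroup Matrix.frobeniusNormedSpace

/-- A Riemannian metric on the `n × n` states: an inner product on each tangent space whose
coefficients depend smoothly on the base point. -/
structure IsRiemannianMetric {n : ℕ} (g : FormField n) : Prop extends IsInnerProductField g where
  smooth : ∀ A ∈ tangent n, ∀ B ∈ tangent n, ContDiffOn ℝ ∞ (fun D => g D A B) (states n)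

end Smooth

/-- A stochastic mapping: a trace-preserving, completely positive linear map. -/
structure IsStochastic {n m : ℕ}
    (T : Matrix (Fin n) (Fin n) ℂ →ₗ[ℂ] Matrix (Fin m) (Fin m) ℂ) : Prop where
  trace_map : ∀ X, (T X).trace = X.trace
  completelyPositive : ∀ (k : ℕ) (a : Fin k → Matrix (Fin m) (Fin m) ℂ)
    (b : Fin k → Matrix (Fin n) (Fin n) ℂ),
    (∑ i, ∑ j, (a i)ᴴ * T ((b i)ᴴ * b j) * a j).PosSemidef

/-- A family of fields, one for each matrix size, is monotone if the differential of each stochastic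
mapping is norm decreasing wherever it maps an invertible density to an invertible density. -/
def IsMonotone (g : ∀ n, FormField n) : Prop :=
  ∀ (n m : ℕ) (T : Matrix (Fin n) (Fin n) ℂ →ₗ[ℂ] Matrix (Fin m) (Fin m) ℂ), IsStochastic T →
    ∀ D ∈ states n, T D ∈ states m → ∀ A ∈ tangent n, g m (T D) (T A) (T A) ≤ g n D A A

/-- The family restricts to the classical Fisher metric on the diagonal density matrices. -/
def IsFisherAdjusted (g : ∀ n, FormField n) : Prop :=
  ∀ (n : ℕ) (p a b : Fin n → ℝ), (∀ i, 0 < p i) → ∑ i, p i = 1 → ∑ i, a i = 0 → ∑ i, b i = 0 →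
    g n (Matrix.diagonal fun i => (p i : ℂ)) (Matrix.diagonal fun i => (a i : ℂ))
      (Matrix.diagonal fun i => (b i : ℂ)) = ∑ i, a i * b i / p i

/-- Operator monotonicity on the half line: `0 ≤ K ≤ H` implies `0 ≤ f(K) ≤ f(H)`, for matrices of
any size. -/
def IsOperatorMonotone (f : ℝ → ℝ) : Prop :=
  ∀ (n : ℕ) (K H : Matrix (Fin n) (Fin n) ℂ) (hK : K.IsHermitian) (hH : H.IsHermitian),
    K.PosSemidef → (H - K).PosSemidef →
      (hK.cfc f).PosSemidef ∧ (hH.cfc f - hK.cfc f).PosSemidef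

/-- The family `g` corresponds to the function `f`: `f` is operator monotone, positive on the
positive half line, symmetric (`f(t) = t f(1/t)`), and at each diagonal state `Diag(p)` the squared
length of `A` is `∑ c(p_j, p_k) |A_jk|²` with `c(x, y) = 1 / (y f(x/y))`. -/
structure CorrespondsTo (g : ∀ n, FormField n) (f : ℝ → ℝ) : Prop where
  operatorMonotone : IsOperatorMonotone f
  pos : ∀ t : ℝ, 0 < t → 0 < f t
  symm : ∀ t : ℝ, 0 < t → f t = t * f t⁻¹
  diagonal : ∀ (n : ℕ) (p : Fin n → ℝ), (∀ i, 0 < p i) → ∑ i, p i = 1 → ∀ A ∈ tangent n,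
    g n (Matrix.diagonal fun i => (p i : ℂ)) A A =
      ∑ j, ∑ k, 1 / (p k * f (p j / p k)) * ‖A j k‖ ^ 2

/-- The metric `½ Tr D⁻¹(AB + BA)`. The trace is real at states and tangent vectors; taking the real
part only makes the value a real number. -/
noncomputable def gRL (n : ℕ) : FormField n :=
  fun D A B => (1 / 2 * (D⁻¹ * (A * B + B * A)).trace : ℂ).re

end DensityMetric

/-! Maximality: a congruence diagonalizes `D` and `A` together, `D = W Wᴴ` and `A = W Diag(l) Wᴴ`.
If `p` lists the squared column lengths of `W`, the stochastic map `preparation W p` sends the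
classical state `Diag(p)` to `D` and the classical tangent vector `Diag(l p)` to `A`. Monotonicity
and the Fisher normalization then bound `g_D(A, A)` by `∑ lᵢ² pᵢ`, which is exactly `Tr A D⁻¹ A =
gRL_D(A, A)`. Monotonicity of `gRL` is the trace of the operator Schwarz inequality
`IsStochastic.schwarz`. Operator monotonicity comes from `2t/(1+t) = 2(1 - 1/(1+t))` and the
antitonicity of inversion. -/

namespace DensityMetric

open Matrix

variable {n m : ℕ}

/-! ### Factorization and simultaneous diagonalization -/

section Factorization

open scoped MatrixOrder

/-- A positive definite matrix is `W Wᴴ` for an invertible `W`. -/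
lemma exists_eq_mul_conjTranspose_of_posDef {D : Matrix (Fin n) (Fin n) ℂ} (hD : D.PosDef) :
    ∃ W : Matrix (Fin n) (Fin n) ℂ, IsUnit W.det ∧ D = W * Wᴴ := by
  obtain ⟨b, hb⟩ := CStarAlgebra.nonneg_iff_eq_star_mul_self.mp
    (Matrix.nonneg_iff_posSemidef.mpr hD.posSemidef)
  refine ⟨bᴴ, ?_, by simpa [star_eq_conjTranspose] using hb⟩
  have h := (Matrix.isUnit_iff_isUnit_det _).mp hD.isUnit
  rw [hb, star_eq_conjTranspose, det_mul] at h
  exact isUnit_of_mul_isUnit_left h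

end Factorization

/-- A Hermitian matrix is unitarily diagonalizable with real eigenvalues. -/
lemma exists_unitary_diagonal {X : Matrix (Fin n) (Fin n) ℂ} (hX : X.IsHermitian) :
    ∃ (U : Matrix (Fin n) (Fin n) ℂ) (l : Fin n → ℝ), U * Uᴴ = 1 ∧ Uᴴ * U = 1 ∧
      X = U * diagonal (fun i => (l i : ℂ)) * Uᴴ := by
  refine ⟨hX.eigenvectorUnitary, hX.eigenvalues, ?_, ?_, ?_⟩
  · exact Unitary.coe_mul_star_self hX.eigenvectorUnitary
  · exact Unitary.coe_star_mul_self hX.eigenvectorUnitary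
  · have h := hX.spectral_theorem
    rw [Unitary.conjStarAlgAut_apply] at h
    exact h

/-- A positive definite and a Hermitian matrix are simultaneously diagonalized by a congruence. -/
lemma exists_simultaneous_diagonal {D A : Matrix (Fin n) (Fin n) ℂ} (hD : D.PosDef)
    (hA : A.IsHermitian) :
    ∃ (W : Matrix (Fin n) (Fin n) ℂ) (l : Fin n → ℝ), IsUnit W.det ∧ D = W * Wᴴ ∧
      A = W * diagonal (fun i => (l i : ℂ)) * Wᴴ := by
  obtain ⟨V, hV, hDV⟩ := exists_eq_mul_conjTranspose_of_posDef hD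
  have hV' : IsUnit (Vᴴ).det := by rw [det_conjTranspose]; exact hV.star
  have hX : (V⁻¹ * A * (Vᴴ)⁻¹).IsHermitian := by
    simp only [IsHermitian, conjTranspose_mul, conjTranspose_nonsing_inv,
      conjTranspose_conjTranspose, hA.eq, mul_assoc]
  obtain ⟨U, l, hU, hU', h⟩ := exists_unitary_diagonal hX
  refine ⟨V * U, l, ?_, ?_, ?_⟩
  · rw [det_mul]
    exact hV.mul (isUnit_det_of_right_inverse hU)
  · rw [conjTranspose_mul, mul_assoc, ← mul_assoc U, hU, one_mul, hDV]
  · calc A = V * (V⁻¹ * A * (Vᴴ)⁻¹) * Vᴴ := by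
          rw [mul_assoc, mul_assoc, nonsing_inv_mul _ hV', mul_one, ← mul_assoc,
            mul_nonsing_inv _ hV, one_mul]
      _ = _ := by rw [h, conjTranspose_mul]; simp only [mul_assoc]

/-! ### Complete positivity -/

section Stochastic

variable {T : Matrix (Fin n) (Fin n) ℂ →ₗ[ℂ] Matrix (Fin m) (Fin m) ℂ}

lemma IsStochastic.isHermitian_map_conjTranspose_mul (hT : IsStochastic T)
    (b : Matrix (Fin n) (Fin n) ℂ) : (T (bᴴ * b)).IsHermitian := by
  have h := hT.completelyPositive 1 (fun _ => 1) (fun _ => b)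
  simpa using h.isHermitian

lemma IsStochastic.isHermitian_map (hT : IsStochastic T) {A : Matrix (Fin n) (Fin n) ℂ}
    (hA : A.IsHermitian) : (T A).IsHermitian := by
  -- Polarization: complete positivity with one term only controls elements `bᴴ b`, so `A` is
  -- written as a difference of two such squares.
  have h : A = (1 / 4 : ℝ) • ((A + 1)ᴴ * (A + 1) - (A - 1)ᴴ * (A - 1)) := by
    simp only [conjTranspose_add, conjTranspose_sub, hA.eq, conjTranspose_one]
    have : (A + 1) * (A + 1) - (A - 1) * (A - 1) = (4 : ℝ) • A := by
      rw [ofNat_smul_eq_nsmul]; noncomm_ring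
    rw [this, smul_smul]; norm_num
  rw [h, T.map_smul_of_tower, map_sub]
  exact ((hT.isHermitian_map_conjTranspose_mul _).sub
    (hT.isHermitian_map_conjTranspose_mul _)).smul (IsSelfAdjoint.all _)

/-- The Schwarz inequality `T(A) T(D)⁻¹ T(A) ≤ T(A D⁻¹ A)` for a completely positive map. -/
lemma IsStochastic.schwarz (hT : IsStochastic T) {D A : Matrix (Fin n) (Fin n) ℂ} (hD : D.PosDef)
    (hTD : (T D).PosDef) (hA : A.IsHermitian) :
    (T (A * D⁻¹ * A) - T A * (T D)⁻¹ * T A).PosSemidef := by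
  obtain ⟨W, hW, hDW⟩ := exists_eq_mul_conjTranspose_of_posDef hD
  have hW' : IsUnit (Wᴴ).det := by rw [det_conjTranspose]; exact hW.star
  have hTA := hT.isHermitian_map hA
  have hTDu := (Matrix.isUnit_iff_isUnit_det _).mp hTD.isUnit
  -- The products `(b i)ᴴ * b j` form the block matrix `[D, A; A, A D⁻¹ A]`. The vector `a`
  -- completes the square, so the quadratic form takes the value of the Schur complement.
  have h := hT.completelyPositive 2 ![-((T D)⁻¹ * T A), 1] ![Wᴴ, W⁻¹ * A]
  have e1 : W * (W⁻¹ * A) = A := by rw [← mul_assoc, mul_nonsing_inv _ hW, one_mul]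
  have e2 : A * (Wᴴ)⁻¹ * Wᴴ = A := by rw [mul_assoc, nonsing_inv_mul _ hW', mul_one]
  have e3 : A * (Wᴴ)⁻¹ * (W⁻¹ * A) = A * D⁻¹ * A := by
    rw [hDW, Matrix.mul_inv_rev]; simp only [mul_assoc]
  have e4 : ((T D)⁻¹)ᴴ = (T D)⁻¹ := hTD.inv.isHermitian
  have e5 : T A * (T D)⁻¹ * T D = T A := by rw [mul_assoc, nonsing_inv_mul _ hTDu, mul_one]
  simp only [Fin.sum_univ_two, Matrix.cons_val_zero, Matrix.cons_val_one, conjTranspose_mul,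
    conjTranspose_neg, conjTranspose_one, conjTranspose_conjTranspose, conjTranspose_nonsing_inv,
    e1, e2, e3, hA.eq, hTA.eq, ← hDW, hTD.isHermitian.eq] at h
  convert h using 1
  simp only [neg_mul, mul_neg, one_mul, mul_one, neg_neg, ← mul_assoc, e5]
  abel

/-- A sum of maps `Z ↦ K Z Kᴴ` is completely positive. -/
lemma posSemidef_kraus_sum {ι : Type*} [Fintype ι] (K : ι → Matrix (Fin m) (Fin n) ℂ) (k : ℕ)
    (a : Fin k → Matrix (Fin m) (Fin m) ℂ) (b : Fin k → Matrix (Fin n) (Fin n) ℂ) :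
    (∑ i, ∑ j, (a i)ᴴ * (∑ l, K l * ((b i)ᴴ * b j) * (K l)ᴴ) * a j).PosSemidef := by
  have h : ∑ i, ∑ j, (a i)ᴴ * (∑ l, K l * ((b i)ᴴ * b j) * (K l)ᴴ) * a j =
      ∑ l, (∑ i, b i * (K l)ᴴ * a i)ᴴ * (∑ i, b i * (K l)ᴴ * a i) := by
    simp only [conjTranspose_sum, Matrix.sum_mul, Matrix.mul_sum, conjTranspose_mul,
      conjTranspose_conjTranspose]
    rw [Finset.sum_comm_cycle]
    refine Finset.sum_congr rfl fun l _ => ?_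
    rw [Finset.sum_comm]
    simp only [Matrix.mul_assoc]
  rw [h]
  exact posSemidef_sum _ fun l _ => posSemidef_conjTranspose_mul_self _

end Stochastic

/-! ### The metric `gRL` -/

lemma gRL_self (D A : Matrix (Fin n) (Fin n) ℂ) :
    gRL n D A A = (D⁻¹ * (A * A)).trace.re := by
  have h : (1 / 2 * (D⁻¹ * (A * A + A * A)).trace : ℂ) = (D⁻¹ * (A * A)).trace := by
    rw [mul_add, trace_add]; ring
  rw [gRL, h]

/-- Taking the adjoint exchanges `A * B` and `B * A`, and cyclicity of the trace restores the
position of `D⁻¹`. -/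
lemma ofReal_gRL {D A B : Matrix (Fin n) (Fin n) ℂ} (hD : D.IsHermitian) (hA : A.IsHermitian)
    (hB : B.IsHermitian) : (gRL n D A B : ℂ) = 1 / 2 * (D⁻¹ * (A * B + B * A)).trace := by
  rw [gRL]
  refine Complex.conj_eq_iff_re.mp ?_
  have h : star (D⁻¹ * (A * B + B * A)).trace = (D⁻¹ * (A * B + B * A)).trace := by
    rw [← trace_conjTranspose, conjTranspose_mul, hD.inv.eq, conjTranspose_add, conjTranspose_mul,
      conjTranspose_mul, hA.eq, hB.eq, trace_mul_comm, add_comm]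
  rw [map_mul]
  congr 1
  rw [show (1 / 2 : ℂ) = ((1 / 2 : ℝ) : ℂ) by norm_num, Complex.conj_ofReal]

lemma gRL_self_eq_trace_mul_inv_mul (D A : Matrix (Fin n) (Fin n) ℂ) :
    gRL n D A A = (A * D⁻¹ * A).trace.re := by
  rw [gRL_self, ← mul_assoc, trace_mul_comm, ← mul_assoc]

lemma gRL_self_pos {D A : Matrix (Fin n) (Fin n) ℂ} (hD : D.PosDef) (hA : A.IsHermitian)
    (h0 : A ≠ 0) : 0 < gRL n D A A := by
  have hps : (A * D⁻¹ * A).PosSemidef := by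
    have := hD.inv.posSemidef.conjTranspose_mul_mul_same A
    rwa [hA.eq] at this
  have hne : (A * D⁻¹ * A).trace ≠ 0 := by
    intro h
    rw [hps.trace_eq_zero_iff] at h
    obtain ⟨W, hW, hDW⟩ := exists_eq_mul_conjTranspose_of_posDef hD.inv
    have h1 : (Wᴴ * A)ᴴ * (Wᴴ * A) = 0 := by
      rw [← h, hDW, conjTranspose_mul, hA.eq, conjTranspose_conjTranspose]
      simp only [mul_assoc]
    rw [conjTranspose_mul_self_eq_zero] at h1
    have hW' : IsUnit (Wᴴ).det := by rw [det_conjTranspose]; exact hW.star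
    apply h0
    rw [← one_mul A, ← nonsing_inv_mul _ hW', mul_assoc, h1, mul_zero]
  rw [gRL_self_eq_trace_mul_inv_mul]
  exact (Complex.lt_def.mp (lt_of_le_of_ne hps.trace_nonneg hne.symm)).1

lemma isInnerProductField_gRL (n : ℕ) : IsInnerProductField (gRL n) where
  add_left D _ A _ B _ C _ := by
    simp only [gRL, ← Complex.add_re, ← mul_add, ← trace_add]
    congr 4
    noncomm_ring
  smul_left D _ c A _ B _ := by
    simp only [gRL, smul_mul_assoc, mul_smul_comm, ← smul_add, trace_smul, Complex.smul_re,
      smul_eq_mul]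
  symm D _ A _ B _ := by rw [gRL, gRL, add_comm]
  pos D hD A hA h0 := gRL_self_pos hD.1 hA.1 h0

section Smooth

attribute [local instance] Matrix.frobeniusNormedAddCommGroup Matrix.frobeniusNormedSpace
  Matrix.frobeniusNormedRing Matrix.frobeniusNormedAlgebra

lemma contDiffAt_matrix_inv {D : Matrix (Fin n) (Fin n) ℂ} (hD : IsUnit D) :
    ContDiffAt ℝ ∞ (fun X : Matrix (Fin n) (Fin n) ℂ => X⁻¹) D := by
  obtain ⟨u, rfl⟩ := hD
  have : CompleteSpace (Matrix (Fin n) (Fin n) ℂ) := FiniteDimensional.complete ℝ _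
  simp only [nonsing_inv_eq_ringInverse]
  exact contDiffAt_ringInverse ℝ u

lemma isRiemannianMetric_gRL (n : ℕ) : IsRiemannianMetric (gRL n) where
  toIsInnerProductField := isInnerProductField_gRL n
  smooth A _ B _ := by
    intro D hD
    -- For fixed `A` and `B` the form is real-linear in `D⁻¹`, so only inversion has to be smooth.
    let L : Matrix (Fin n) (Fin n) ℂ →ₗ[ℝ] ℝ :=
      { toFun := fun X => (1 / 2 * (X * (A * B + B * A)).trace : ℂ).re
        map_add' := fun X Y => by rw [add_mul, trace_add, mul_add, Complex.add_re]
        map_smul' := fun c X => by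
          rw [smul_mul_assoc, trace_smul, mul_smul_comm, Complex.smul_re, RingHom.id_apply] }
    exact (L.toContinuousLinearMap.contDiff.contDiffAt.comp D
      (contDiffAt_matrix_inv hD.1.isUnit)).contDiffWithinAt

end Smooth

lemma isMonotone_gRL : IsMonotone gRL := by
  intro n m T hT D hD hTD A hA
  have h := (hT.schwarz hD.1 hTD.1 hA.1).trace_nonneg
  rw [trace_sub, hT.trace_map] at h
  rw [gRL_self_eq_trace_mul_inv_mul, gRL_self_eq_trace_mul_inv_mul]
  have := (Complex.le_def.mp h).1
  simpa using this

lemma inv_diagonal_ofReal {p : Fin n → ℝ} (hp : ∀ i, 0 < p i) :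
    (diagonal fun i => (p i : ℂ))⁻¹ = diagonal fun i => ((p i)⁻¹ : ℂ) := by
  apply Matrix.inv_eq_left_inv
  rw [diagonal_mul_diagonal, ← diagonal_one]
  congr 1
  ext i
  exact inv_mul_cancel₀ (Complex.ofReal_ne_zero.mpr (hp i).ne')

lemma isFisherAdjusted_gRL : IsFisherAdjusted gRL := by
  intro n p a b hp _ _ _
  rw [gRL, inv_diagonal_ofReal hp]
  simp only [diagonal_mul_diagonal, diagonal_add, trace_diagonal, Finset.mul_sum, Complex.re_sum]
  refine Finset.sum_congr rfl fun i _ => ?_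
  have : (1 / 2 * ((p i : ℂ)⁻¹ * (a i * b i + b i * a i)) : ℂ) = ((a i * b i / p i : ℝ) : ℂ) := by
    push_cast; ring
  rw [this, Complex.ofReal_re]

lemma gRL_diagonal {p : Fin n → ℝ} (hp : ∀ i, 0 < p i) {A : Matrix (Fin n) (Fin n) ℂ}
    (hA : A.IsHermitian) :
    gRL n (diagonal fun i => (p i : ℂ)) A A = ∑ j, ∑ k, (p j)⁻¹ * ‖A j k‖ ^ 2 := by
  rw [gRL_self, inv_diagonal_ofReal hp, trace, Complex.re_sum]
  refine Finset.sum_congr rfl fun j _ => ?_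
  rw [diag_apply, diagonal_mul, mul_apply, Finset.mul_sum, Complex.re_sum]
  refine Finset.sum_congr rfl fun k _ => ?_
  rw [← hA.apply k j, ← starRingEnd_apply, Complex.mul_conj, Complex.normSq_eq_norm_sq,
    ← Complex.ofReal_inv, ← Complex.ofReal_mul, Complex.ofReal_re]

/-- Since `‖A j k‖` is symmetric in `j, k`, the weight `1 / p j` may be averaged with `1 / p k`; the
average is `c(p j, p k)`. -/
lemma gRL_diagonal_eq_sum_harmonic {p : Fin n → ℝ} (hp : ∀ i, 0 < p i)
    {A : Matrix (Fin n) (Fin n) ℂ} (hA : A.IsHermitian) :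
    gRL n (diagonal fun i => (p i : ℂ)) A A =
      ∑ j, ∑ k, 1 / (p k * (2 * (p j / p k) / (1 + p j / p k))) * ‖A j k‖ ^ 2 := by
  have h1 := gRL_diagonal hp hA
  have h2 : gRL n (diagonal fun i => (p i : ℂ)) A A = ∑ j, ∑ k, (p k)⁻¹ * ‖A j k‖ ^ 2 := by
    rw [h1, Finset.sum_comm]
    refine Finset.sum_congr rfl fun j _ => Finset.sum_congr rfl fun k _ => ?_
    rw [← hA.apply, norm_star]
  have h3 : ∀ j k, 1 / (p k * (2 * (p j / p k) / (1 + p j / p k))) * ‖A j k‖ ^ 2 =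
      1 / 2 * ((p j)⁻¹ * ‖A j k‖ ^ 2) + 1 / 2 * ((p k)⁻¹ * ‖A j k‖ ^ 2) := by
    intro j k
    have := hp j
    have := hp k
    field_simp
  have h4 : ∀ F : Fin n → Fin n → ℝ, ∑ j, ∑ k, 1 / 2 * F j k = 1 / 2 * ∑ j, ∑ k, F j k :=
    fun F => by simp only [Finset.mul_sum]
  simp only [h3, Finset.sum_add_distrib]
  rw [h4, h4, ← h1, ← h2]
  ring

/-! ### Operator monotonicity of the harmonic mean -/

/-- Inversion is operator antitone. -/
lemma posSemidef_inv_sub_inv {A B : Matrix (Fin n) (Fin n) ℂ} (hA : A.PosDef) (hB : B.PosDef)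
    (h : (B - A).PosSemidef) : (A⁻¹ - B⁻¹).PosSemidef := by
  have hAu := (Matrix.isUnit_iff_isUnit_det _).mp hA.isUnit
  have hBu := (Matrix.isUnit_iff_isUnit_det _).mp hB.isUnit
  have h1 := hA.posSemidef.conjTranspose_mul_mul_same (A⁻¹ - B⁻¹)
  have h2 := h.conjTranspose_mul_mul_same B⁻¹
  rw [conjTranspose_sub, hA.inv.isHermitian.eq, hB.inv.isHermitian.eq] at h1
  rw [hB.inv.isHermitian.eq] at h2
  -- `A⁻¹ - B⁻¹ = (A⁻¹ - B⁻¹) A (A⁻¹ - B⁻¹) + B⁻¹ (B - A) B⁻¹`.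
  convert h1.add h2 using 1
  simp only [sub_mul, mul_sub, nonsing_inv_mul _ hAu, nonsing_inv_mul _ hBu, one_mul, mul_assoc,
    mul_nonsing_inv _ hAu, mul_one]
  abel

lemma cfc_harmonic {K : Matrix (Fin n) (Fin n) ℂ} (hK : K.IsHermitian) (h : K.PosSemidef) :
    hK.cfc (fun t => 2 * t / (1 + t)) = (2 : ℝ) • (1 - (1 + K)⁻¹) := by
  have hl : ∀ i, 0 ≤ hK.eigenvalues i := h.eigenvalues_nonneg
  let U : Matrix (Fin n) (Fin n) ℂ := hK.eigenvectorUnitary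
  have hU : U * Uᴴ = 1 := Unitary.coe_mul_star_self hK.eigenvectorUnitary
  have hU' : Uᴴ * U = 1 := Unitary.coe_star_mul_self hK.eigenvectorUnitary
  have hsp : K = U * diagonal (fun i => (hK.eigenvalues i : ℂ)) * Uᴴ := by
    have h := hK.spectral_theorem
    rw [Unitary.conjStarAlgAut_apply] at h
    exact h
  have hcfc : hK.cfc (fun t => 2 * t / (1 + t)) = U * diagonal (fun i =>
      ((2 * hK.eigenvalues i / (1 + hK.eigenvalues i) : ℝ) : ℂ)) * Uᴴ := by
    rw [IsHermitian.cfc, Unitary.conjStarAlgAut_apply]; rfl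
  have h1 : 1 + K = U * diagonal (fun i => ((1 + hK.eigenvalues i : ℝ) : ℂ)) * Uᴴ := by
    have : diagonal (fun i => ((1 + hK.eigenvalues i : ℝ) : ℂ)) =
        1 + diagonal (fun i => (hK.eigenvalues i : ℂ)) := by
      rw [← diagonal_one, diagonal_add]; simp
    rw [this, mul_add, add_mul, mul_one, hU, ← hsp]
  have h2 : (1 + K)⁻¹ = U * diagonal (fun i => (((1 + hK.eigenvalues i)⁻¹ : ℝ) : ℂ)) * Uᴴ := by
    apply Matrix.inv_eq_left_inv
    rw [h1]
    calc _ = U * (diagonal (fun i => (((1 + hK.eigenvalues i)⁻¹ : ℝ) : ℂ)) * (Uᴴ * U) *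
          diagonal (fun i => ((1 + hK.eigenvalues i : ℝ) : ℂ))) * Uᴴ := by simp only [mul_assoc]
      _ = 1 := by
        rw [hU', mul_one, diagonal_mul_diagonal]
        have : (fun i => (((1 + hK.eigenvalues i)⁻¹ : ℝ) : ℂ) *
            ((1 + hK.eigenvalues i : ℝ) : ℂ)) = 1 := by
          ext i
          rw [← Complex.ofReal_mul, inv_mul_cancel₀ (by linarith [hl i]), Complex.ofReal_one,
            Pi.one_apply]
        rw [this, diagonal_one', mul_one, hU]
  rw [hcfc, h2, ← hU]
  have h3 : diagonal (fun i => ((2 * hK.eigenvalues i / (1 + hK.eigenvalues i) : ℝ) : ℂ)) =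
      (2 : ℝ) • (1 - diagonal (fun i => (((1 + hK.eigenvalues i)⁻¹ : ℝ) : ℂ))) := by
    rw [← diagonal_one, diagonal_sub, ← diagonal_smul]
    congr 1
    ext i
    have h0 : (1 + hK.eigenvalues i) ≠ 0 := by linarith [hl i]
    have : 2 * hK.eigenvalues i / (1 + hK.eigenvalues i) =
        2 * (1 - (1 + hK.eigenvalues i)⁻¹) := by field_simp; ring
    rw [this]
    simp
  rw [h3, mul_smul_comm, smul_mul_assoc, mul_sub, sub_mul, mul_one]

lemma isOperatorMonotone_harmonic : IsOperatorMonotone (fun t => 2 * t / (1 + t)) := by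
  intro n K H hK hH hKp hHK
  have hHp : H.PosSemidef := by simpa using hHK.add hKp
  have hK1 : (1 + K).PosDef := PosDef.one.add_posSemidef hKp
  have hH1 : (1 + H).PosDef := PosDef.one.add_posSemidef hHp
  have h2 : (0 : ℝ) ≤ 2 := by norm_num
  rw [cfc_harmonic hK hKp, cfc_harmonic hH hHp]
  constructor
  · have := posSemidef_inv_sub_inv PosDef.one hK1 (by simpa using hKp)
    rw [inv_one] at this
    exact this.smul h2
  · rw [← smul_sub, sub_sub_sub_cancel_left]
    exact (posSemidef_inv_sub_inv hK1 hH1 (by simpa using hHK)).smul h2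

lemma correspondsTo_gRL : CorrespondsTo gRL (fun t => 2 * t / (1 + t)) where
  operatorMonotone := isOperatorMonotone_harmonic
  pos t ht := by positivity
  symm t ht := by
    field_simp
    ring
  diagonal _ _ hp _ _ hA := gRL_diagonal_eq_sum_harmonic hp hA.1

/-! ### Maximality -/

section Largest

/-- The preparation map `Z ↦ ∑ₗ (Zₗₗ / pₗ) wₗ wₗᴴ`, where the `wₗ` are the columns of `W`. -/
noncomputable def preparation (W : Matrix (Fin n) (Fin n) ℂ) (p : Fin n → ℝ) :
    Matrix (Fin n) (Fin n) ℂ →ₗ[ℂ] Matrix (Fin n) (Fin n) ℂ where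
  toFun Z := W * diagonal (fun l => Z l l / (p l : ℂ)) * Wᴴ
  map_add' X Y := by
    rw [← add_mul, ← mul_add, diagonal_add]
    simp [add_div]
  map_smul' c X := by
    rw [RingHom.id_apply, ← smul_mul_assoc, ← mul_smul_comm, ← diagonal_smul]
    congr 3
    ext l
    simp [mul_div_assoc]

lemma preparation_apply (W : Matrix (Fin n) (Fin n) ℂ) (p : Fin n → ℝ)
    (Z : Matrix (Fin n) (Fin n) ℂ) :
    preparation W p Z = W * diagonal (fun l => Z l l / (p l : ℂ)) * Wᴴ := rfl

lemma trace_mul_diagonal_mul_conjTranspose {W : Matrix (Fin n) (Fin n) ℂ} {p : Fin n → ℝ}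
    (hW : ∀ l, (Wᴴ * W) l l = p l) (d : Fin n → ℂ) :
    (W * diagonal d * Wᴴ).trace = ∑ l, d l * p l := by
  rw [trace_mul_comm, ← mul_assoc, trace]
  refine Finset.sum_congr rfl fun l _ => ?_
  rw [diag_apply, mul_diagonal, hW, mul_comm]

lemma isStochastic_preparation {W : Matrix (Fin n) (Fin n) ℂ} {p : Fin n → ℝ}
    (hp : ∀ l, 0 < p l) (hW : ∀ l, (Wᴴ * W) l l = p l) : IsStochastic (preparation W p) where
  trace_map Z := by
    rw [preparation_apply, trace_mul_diagonal_mul_conjTranspose hW, trace]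
    refine Finset.sum_congr rfl fun l _ => ?_
    exact div_mul_cancel₀ _ (Complex.ofReal_ne_zero.mpr (hp l).ne')
  completelyPositive k a b := by
    -- Kraus form: the `l`-th operator is `W E_ll / √(p l)`.
    have h : ∀ Z, preparation W p Z = ∑ l, (W * single l l ((√(p l))⁻¹ : ℂ)) * Z *
        (W * single l l ((√(p l))⁻¹ : ℂ))ᴴ := by
      intro Z
      have : ∀ l, (W * single l l ((√(p l))⁻¹ : ℂ)) * Z * (W * single l l ((√(p l))⁻¹ : ℂ))ᴴ =
          W * single l l (Z l l / (p l : ℂ)) * Wᴴ := by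
        intro l
        have h1 : single l l ((√(p l))⁻¹ : ℂ) * Z * (single l l ((√(p l))⁻¹ : ℂ))ᴴ =
            single l l (Z l l / (p l : ℂ)) := by
          rw [conjTranspose_single, single_mul_mul_single]
          congr 1
          have h2 : ((√(p l) : ℝ) : ℂ) * (√(p l) : ℝ) = p l := by
            rw [← Complex.ofReal_mul, Real.mul_self_sqrt (hp l).le]
          rw [← h2, star_inv₀, ← starRingEnd_apply, Complex.conj_ofReal, div_eq_mul_inv, mul_inv]
          ring
        rw [← h1, conjTranspose_mul]
        simp only [mul_assoc]
      simp only [this]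
      rw [← Finset.sum_mul, ← Finset.mul_sum, preparation_apply, ← sum_single_eq_diagonal]
    simp only [h]
    exact posSemidef_kraus_sum _ k a b

lemma le_gRL_of_isMonotone_of_isFisherAdjusted {g : ∀ n, FormField n} (hmono : IsMonotone g)
    (hfish : IsFisherAdjusted g) {D A : Matrix (Fin n) (Fin n) ℂ} (hD : D ∈ states n)
    (hA : A ∈ tangent n) : g n D A A ≤ gRL n D A A := by
  obtain ⟨W, l, hW, hDW, hAW⟩ := exists_simultaneous_diagonal hD.1 hA.1
  have hpd : (Wᴴ * W).PosDef := by
    refine PosDef.conjTranspose_mul_self W ?_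
    exact Matrix.mulVec_injective_iff_isUnit.mpr ((Matrix.isUnit_iff_isUnit_det _).mpr hW)
  have hW' : IsUnit (Wᴴ).det := by rw [det_conjTranspose]; exact hW.star
  obtain ⟨p, hp, hpW⟩ : ∃ p : Fin n → ℝ, (∀ i, 0 < p i) ∧ ∀ i, (Wᴴ * W) i i = p i := by
    refine ⟨fun i => ((Wᴴ * W) i i).re, fun i => (Complex.lt_def.mp hpd.diag_pos).1, fun i => ?_⟩
    exact (Complex.conj_eq_iff_re.mp (hpd.isHermitian.apply i i)).symm
  have hpC : ∀ i, (p i : ℂ) ≠ 0 := fun i => Complex.ofReal_ne_zero.mpr (hp i).ne'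
  have htr := trace_mul_diagonal_mul_conjTranspose hpW
  have hsum : ∑ i, p i = 1 := by
    have h := htr (fun _ => 1)
    rw [diagonal_one, mul_one, ← hDW, hD.2] at h
    simp only [one_mul] at h
    exact_mod_cast h.symm
  have hsum0 : ∑ i, l i * p i = 0 := by
    have h := htr (fun i => (l i : ℂ))
    rw [← hAW, hA.2] at h
    exact_mod_cast h.symm
  have hTD : preparation W p (diagonal fun i => (p i : ℂ)) = D := by
    rw [preparation_apply]
    simp only [diagonal_apply_eq, div_self (hpC _)]
    rw [diagonal_one, mul_one, ← hDW]
  -- The factor `p i` cancels the division built into `preparation`, leaving `Diag(l)` between `W`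
  -- and `Wᴴ`.
  have hTA : preparation W p (diagonal fun i => ((l i * p i : ℝ) : ℂ)) = A := by
    rw [preparation_apply]
    simp only [diagonal_apply_eq, Complex.ofReal_mul, mul_div_cancel_right₀ _ (hpC _)]
    exact hAW.symm
  have hpst : (diagonal fun i => (p i : ℂ)) ∈ states n := by
    refine ⟨PosDef.diagonal fun i => ?_, ?_⟩
    · exact_mod_cast hp i
    · rw [trace_diagonal]; exact_mod_cast hsum
  have hatan : (diagonal fun i => ((l i * p i : ℝ) : ℂ)) ∈ tangent n := by
    refine ⟨isHermitian_diagonal_of_self_adjoint _ ?_, ?_⟩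
    · ext i; simp
    · rw [trace_diagonal]; exact_mod_cast hsum0
  have key := hmono n n (preparation W p) (isStochastic_preparation hp hpW) _ hpst
    (by rw [hTD]; exact hD) _ hatan
  rw [hTD, hTA, hfish n p _ _ hp hsum hsum0 hsum0] at key
  refine key.trans_eq ?_
  -- The trace of the right side is `∑ lᵢ² pᵢ`, the Fisher length `∑ (lᵢ pᵢ)² / pᵢ`.
  have hAA : A * D⁻¹ * A = W * diagonal (fun i => ((l i * l i : ℝ) : ℂ)) * Wᴴ := by
    rw [hDW, Matrix.mul_inv_rev, hAW]
    calc _ = W * diagonal (fun i => (l i : ℂ)) * (Wᴴ * (Wᴴ)⁻¹) * (W⁻¹ * W) *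
          diagonal (fun i => (l i : ℂ)) * Wᴴ := by simp only [mul_assoc]
      _ = _ := by
        rw [mul_nonsing_inv _ hW', nonsing_inv_mul _ hW, mul_one, mul_one, mul_assoc W,
          diagonal_mul_diagonal]
        simp only [Complex.ofReal_mul]
  rw [gRL_self_eq_trace_mul_inv_mul, hAA, htr, Complex.re_sum]
  refine Finset.sum_congr rfl fun i _ => ?_
  rw [← Complex.ofReal_mul, Complex.ofReal_re]
  have := (hp i).ne'
  field_simp

end Largest

end DensityMetric

theorem theorem3p2 :
    -- the formula defining the metric is real valued
    (∀ n, ∀ D ∈ DensityMetric.states n, ∀ A ∈ DensityMetric.tangent n,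
      ∀ B ∈ DensityMetric.tangent n,
        (DensityMetric.gRL n D A B : ℂ) = 1 / 2 * (D⁻¹ * (A * B + B * A)).trace) ∧
    -- it is a Fisher-adjusted monotone Riemannian metric
    (∀ n, DensityMetric.IsRiemannianMetric (DensityMetric.gRL n)) ∧
    DensityMetric.IsMonotone DensityMetric.gRL ∧
    DensityMetric.IsFisherAdjusted DensityMetric.gRL ∧
    -- it corresponds to the harmonic mean
    DensityMetric.CorrespondsTo DensityMetric.gRL (fun t => 2 * t / (1 + t)) ∧
    -- it dominates every Fisher-adjusted monotone metric
    (∀ g : ∀ n, DensityMetric.FormField n,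
      (∀ n, DensityMetric.IsInnerProductField (g n)) →
      DensityMetric.IsMonotone g → DensityMetric.IsFisherAdjusted g →
        ∀ n, ∀ D ∈ DensityMetric.states n, ∀ A ∈ DensityMetric.tangent n,
          g n D A A ≤ DensityMetric.gRL n D A A) := by
  refine ⟨fun n D hD A hA B hB => DensityMetric.ofReal_gRL hD.1.isHermitian hA.1 hB.1,
    DensityMetric.isRiemannianMetric_gRL, DensityMetric.isMonotone_gRL,
    DensityMetric.isFisherAdjusted_gRL, DensityMetric.correspondsTo_gRL, ?_⟩
  intro g _ hmono hfish n D hD A hA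
  exact DensityMetric.le_gRL_of_isMonotone_of_isFisherAdjusted hmono hfish hD hA
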